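/- Let $\Pi$ be a group (for instance the fundamental group of a finite CW-complex), and let $\mathcal G$ be the set of its finite-index subgroups. For $\Gamma\in\mathcal G$ the group $\Pi$ acts on the right on the finite set $\Gamma\backslash\Pi$ of right cosets, hence on the vector space $\mathbb C[\Gamma\backslash\Pi]$, which carries the inner product for which $\Gamma\backslash\Pi$ is an orthonormal basis; put $\mathrm{tr}_{\Gamma\backslash\Pi}(g)=\mathrm{tr}(g,\mathbb C[\Gamma\backslash\Pi])/[\Pi:\Gamma]$ for $g\in\Pi$. For a sequence $(\Gamma_k)$ in $\mathcal G$ write $\Gamma_k\xrightarrow{\mathrm{tr}}1$ if for every $g\in\Pi$ the numbers $\mathrm{tr}_{\Gamma_k\backslash\Pi}(g)$ converge, as $k\to\infty$, to $1$ if $g=e$ and to $0$ if $g\ne e$. For $f:\mathcal G\to\mathbb R$ let $\limsup_{\mathcal G\ni\Gamma\xrightarrow{\mathrm{tr}}1}f(\Gamma)\in[-\infty,\infty]$ be the infimum of all $L$ such that $\limsup_{k\to\infty}f(\Gamma_k)\le L$ for every sequence with $\Gamma_k\xrightarrow{\mathrm{tr}}1$. Let $B$ be an $n\times m$ matrix over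 $\mathbb Z[\Pi]$. Let $T:\ell^2(\Pi)^n\to\ell^2(\Pi)^m$ and, for $\Gamma\in\mathcal G$, $B_\Gamma:\mathbb C[\Gamma\backslash\Pi]^n\to\mathbb C[\Gamma\backslash\Pi]^m$ be the operators $x\mapsto xB$, and let $\det'(B_\Gamma)>0$ be the product of the nonzero singular values of $B_\Gamma$, with multiplicity (equal to $1$ if $B_\Gamma=0$). Let $(P(\lambda))_{\lambda\ge0}$ be the right continuous spectral family of the positive operator $T^*T$, and let $F(\lambda)=\mathrm{tr}_\Pi(P(\lambda))=\sum_{j=1}^n\langle e_j,P(\lambda)e_j\rangle$, where $e_j\in\ell^2(\Pi)^n$ has the unit element $e$ of $\Pi$ in position $j$ and $0$ elsewhere. The matrix $B$ is in the determinantal class if $\int_{0^+}^\infty\ln\lambda\,dF(\lambda)$ exists as a real number, and then its Fuglede–Kadison determinant is $\det_\Pi(B)=\exp\bigl(\tfrac12\int_{0^+}^\infty\ln\lambda\,dF(\lambda)\bigr)>0$. Theorem. If $B$ is in the determinantal class, then $$\limsup_{\mathcal G\ni\Gamma\xrightarrow{\mathrm{tr}}1}\frac{\ln\det'(B_\Gamma)}{[\Pi:\Gamma]}\le\ln\det_\Pi(B).$$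 -/

import Mathlib

noncomputable section

namespace L2Det

open Filter Topology MeasureTheory Set

/-! ## Density functions and their determinants -/

/-- A density function: an increasing right continuous function `F : [0, ∞) → [0, ∞)` which is
constant on some `(C, ∞)`.  It is extended by `0` to the negative half-line; the measure `dF` is
only ever used on `(0, ∞)`, so this convention plays no role. -/
structure DensityFunction extends StieltjesFunction ℝ where
  zero_of_neg' : ∀ x < 0, toFun x = 0
  eventually_const' : ∃ C : ℝ, ∀ x > C, toFun x = toFun C

/-- `F` is in the determinantal class if `∫_{0⁺}^∞ ln λ dF` exists as a real number.
(As `dF` lives on a bounded interval, only the behaviour near `0` matters, where `ln` has constant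
sign, so that existence as an improper integral is the same as Lebesgue integrability.) -/
def DensityFunction.IsDetClass (F : DensityFunction) : Prop :=
  IntegrableOn Real.log (Ioi 0) F.toStieltjesFunction.measure

open scoped Classical in
/-- The determinant `exp (∫_{0⁺}^∞ ln λ dF)` of a density function, `0` outside the
determinantal class. -/
def DensityFunction.det (F : DensityFunction) : ℝ :=
  if F.IsDetClass then Real.exp (∫ x in Ioi 0, Real.log x ∂F.toStieltjesFunction.measure) else 0

/-! ## The spectral family of a self-adjoint operator -/

section Spectral

variable {H : Type*} [NormedAddCommGroup H] [InnerProductSpace ℂ H] [CompleteSpace H]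

/-- `(A - λ)⁺`, the positive part of `A - λ`. -/
def posPartSub (A : H →L[ℂ] H) (lam : ℝ) : H →L[ℂ] H :=
  cfc (fun t : ℝ => max (t - lam) 0) A

/-- The right continuous spectral family `P(λ) = 1_{(-∞, λ]}(A)` of a bounded self-adjoint operator
`A`: `P(λ)` is the orthogonal projection onto the null space of `(A - λ)⁺`. -/
def spectralProj (A : H →L[ℂ] H) (lam : ℝ) : H →L[ℂ] H :=
  (posPartSub A lam).ker.starProjection

theorem posPartSub_isSelfAdjoint (A : H →L[ℂ] H) (lam : ℝ) : IsSelfAdjoint (posPartSub A lam) :=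
  cfc_predicate _ _

theorem ker_posPartSub_mono (A : H →L[ℂ] H) {lam mu : ℝ} (h : lam ≤ mu) :
    (posPartSub A lam).ker ≤ (posPartSub A mu).ker := by
  rcases h.eq_or_lt with rfl | h
  · exact le_rfl
  have key : posPartSub A mu =
      cfc (fun t : ℝ => max (t - mu) 0 / max (t - lam) (mu - lam)) A * posPartSub A lam := by
    have hpos : ∀ t : ℝ, max (t - lam) (mu - lam) ≠ 0 := fun t =>
      (lt_of_lt_of_le (sub_pos.2 h) (le_max_right _ _)).ne'
    have hc : Continuous (fun t : ℝ => max (t - mu) 0 / max (t - lam) (mu - lam)) :=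
      Continuous.div (by fun_prop) (by fun_prop) hpos
    unfold posPartSub
    rw [← cfc_mul _ _ A hc.continuousOn (by fun_prop)]
    congr 1
    funext t
    rcases le_total t mu with ht | ht
    · simp [max_eq_right (sub_nonpos.2 ht)]
    · rw [max_eq_left (sub_nonneg.2 ht), max_eq_left (a := t - lam) (by linarith),
        max_eq_left (by linarith), div_mul_cancel₀]
      linarith
  intro x hx
  have hx' : posPartSub A lam x = 0 := hx
  change posPartSub A mu x = 0
  rw [key, mul_apply_eq_comp, hx', map_zero]

theorem norm_posPartSub_sub_le (A : H →L[ℂ] H) {lam mu : ℝ} (h : lam ≤ mu) :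
    ‖posPartSub A lam - posPartSub A mu‖ ≤ mu - lam := by
  unfold posPartSub
  rw [← cfc_sub _ _ A (by fun_prop) (by fun_prop)]
  refine norm_cfc_le (by linarith) fun t _ => ?_
  rw [Real.norm_eq_abs, abs_le]
  constructor <;>
    rcases max_cases (t - lam) 0 with h1 | h1 <;>
    rcases max_cases (t - mu) 0 with h2 | h2 <;> linarith

theorem inner_spectralProj (A : H →L[ℂ] H) (lam : ℝ) (x : H) :
    (inner ℂ x (spectralProj A lam x)).re = ‖spectralProj A lam x‖ ^ 2 := by
  have h := Submodule.re_inner_starProjection_eq_normSq (K := (posPartSub A lam).ker) x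
  rw [← inner_conj_symm, Complex.conj_re]
  simpa [spectralProj] using h

theorem norm_spectralProj_mono (A : H →L[ℂ] H) (x : H) :
    Monotone fun lam : ℝ => ‖spectralProj A lam x‖ := by
  intro lam mu h
  have h1 := Submodule.starProjection_comp_starProjection_of_le (ker_posPartSub_mono A h)
  have h2 : spectralProj A lam x = spectralProj A lam (spectralProj A mu x) :=
    (DFunLike.congr_fun h1 x).symm
  dsimp only
  rw [h2]
  exact Submodule.norm_starProjection_apply_le _ _

theorem spectralProj_continuousWithinAt (A : H →L[ℂ] H) (lam : ℝ) (x : H) :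
    ContinuousWithinAt (fun mu => spectralProj A mu x) (Ici lam) lam := by
  rw [Metric.continuousWithinAt_iff]
  intro ε hε
  set p := spectralProj A lam x with hp
  have hpmem : p ∈ (posPartSub A lam).ker := Submodule.starProjection_apply_mem _ _
  have hy : x - p ∈ (posPartSub A lam).rangeᗮᗮ := by
    rw [ContinuousLinearMap.orthogonal_range,
      ← ContinuousLinearMap.star_eq_adjoint, (posPartSub_isSelfAdjoint A lam).star_eq]
    exact Submodule.sub_starProjection_mem_orthogonal _
  rw [Submodule.orthogonal_orthogonal_eq_closure] at hy
  obtain ⟨_, ⟨z, rfl⟩, hz⟩ := Metric.mem_closure_iff.1 hy (ε / 2) (by positivity)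
  refine ⟨ε / (2 * (‖z‖ + 1)), by positivity, fun mu hmu hd => ?_⟩
  have hle : lam ≤ mu := hmu
  have hpm : spectralProj A mu p = p :=
    Submodule.starProjection_eq_self_iff.2 (ker_posPartSub_mono A hle hpmem)
  have h0 : spectralProj A mu (posPartSub A mu z) = 0 := by
    refine (Submodule.starProjection_apply_eq_zero_iff (K := (posPartSub A mu).ker)).2 ?_
    intro w hw
    have hw' : posPartSub A mu w = 0 := hw
    have hsa := (posPartSub_isSelfAdjoint A mu).adjoint_eq
    rw [← ContinuousLinearMap.adjoint_inner_left, hsa, hw', inner_zero_left]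
  have hsplit : spectralProj A mu x - p =
      spectralProj A mu ((x - p) - posPartSub A lam z) +
        spectralProj A mu ((posPartSub A lam - posPartSub A mu) z) := by
    simp only [sub_apply, map_sub, hpm, h0]
    abel
  have hnorm : ∀ v, ‖spectralProj A mu v‖ ≤ ‖v‖ := Submodule.norm_starProjection_apply_le _
  rw [dist_eq_norm, hsplit]
  have e1 := hnorm ((x - p) - posPartSub A lam z)
  have e2 := hnorm ((posPartSub A lam - posPartSub A mu) z)
  have e3 := (posPartSub A lam - posPartSub A mu).le_of_opNorm_le (norm_posPartSub_sub_le A hle) z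
  have e4 : ‖(x - p) - posPartSub A lam z‖ < ε / 2 := by
    rw [← dist_eq_norm]; exact hz
  have e5 : (mu - lam) * ‖z‖ ≤ ε / 2 := by
    rw [Real.dist_eq, abs_of_nonneg (by linarith), lt_div_iff₀ (by positivity)] at hd
    nlinarith [norm_nonneg z]
  calc _ ≤ _ := norm_add_le _ _
    _ < ε := by linarith

theorem spectralProj_of_neg {A : H →L[ℂ] H} (hA : 0 ≤ A) {lam : ℝ} (h : lam < 0) :
    spectralProj A lam = 0 := by
  have hsa : IsSelfAdjoint A := IsSelfAdjoint.of_nonneg hA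
  have hne : ∀ t : ℝ, max (t - lam) (-lam) ≠ 0 := fun t =>
    (lt_of_lt_of_le (neg_pos.2 h) (le_max_right _ _)).ne'
  have key : cfc (fun t : ℝ => (max (t - lam) (-lam))⁻¹) A * posPartSub A lam = 1 := by
    unfold posPartSub
    have hc : Continuous (fun t : ℝ => (max (t - lam) (-lam))⁻¹) :=
      Continuous.inv₀ (by fun_prop) hne
    rw [← cfc_mul _ _ A hc.continuousOn (by fun_prop), ← cfc_const_one ℝ A]
    refine cfc_congr fun t ht => ?_
    have ht0 : 0 ≤ t := spectrum_nonneg_of_nonneg hA ht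
    change _ = (1 : ℝ)
    rw [max_eq_left (by linarith), max_eq_left (by linarith), inv_mul_cancel₀]
    linarith
  have hker : (posPartSub A lam).ker = ⊥ := by
    rw [eq_bot_iff]
    intro x hx
    have hx' : posPartSub A lam x = 0 := hx
    have := DFunLike.congr_fun key x
    rw [mul_apply_eq_comp, hx', map_zero] at this
    simpa using this.symm
  unfold spectralProj
  simp [hker]

theorem spectralProj_of_norm_le {A : H →L[ℂ] H} {lam : ℝ} (h : ‖A‖ ≤ lam) :
    spectralProj A lam = 1 := by
  have hz : posPartSub A lam = 0 := by
    unfold posPartSub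
    rw [← cfc_const_zero ℝ A]
    refine cfc_congr fun t ht => ?_
    have h1 : ‖t‖ ≤ ‖A‖ * ‖(1 : H →L[ℂ] H)‖ := spectrum.norm_le_norm_mul_of_mem ht
    have h2 : ‖(1 : H →L[ℂ] H)‖ ≤ 1 := ContinuousLinearMap.norm_id_le
    have h3 : t ≤ ‖t‖ := Real.le_norm_self t
    exact max_eq_right (by nlinarith [norm_nonneg A])
  unfold spectralProj
  simp [hz, Submodule.starProjection_top']

end Spectral

/-! ## Matrices over a group ring acting by right multiplication -/

section Action

variable {G : Type*} [Group G] {H : Type*} [NormedAddCommGroup H] [InnerProductSpace ℂ H]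

/-- Given a unitary right action of `G` on `H` and `b = ∑ c_g g ∈ ℂ[G]`, the operator
`x ↦ x b = ∑ c_g (x g)`. -/
def rightMul (R : Gᵐᵒᵖ →* (H ≃ₗᵢ[ℂ] H)) (b : MonoidAlgebra ℂ G) : H →L[ℂ] H :=
  b.coeff.sum fun g c => c • ((R (MulOpposite.op g)).toContinuousLinearEquiv : H →L[ℂ] H)

/-- The operator `Hⁿ → Hᵐ`, `x ↦ x B`, that is `(x B)_j = ∑ i, x_i B_{ij}`. -/
def matMul (R : Gᵐᵒᵖ →* (H ≃ₗᵢ[ℂ] H)) {n m : ℕ} (B : Matrix (Fin n) (Fin m) (MonoidAlgebra ℂ G)) :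
    PiLp 2 (fun _ : Fin n => H) →L[ℂ] PiLp 2 (fun _ : Fin m => H) :=
  ((PiLp.continuousLinearEquiv 2 ℂ (fun _ : Fin m => H)).symm :
      (Fin m → H) →L[ℂ] PiLp 2 (fun _ : Fin m => H)) ∘L
    ContinuousLinearMap.pi fun j =>
      ∑ i, rightMul R (B i j) ∘L PiLp.proj 2 (fun _ : Fin n => H) i

end Action

/-- A matrix over `ℤ[G]` regarded as a matrix over `ℂ[G]`. -/
def complexify {G : Type*} [Group G] {n m : ℕ} (B : Matrix (Fin n) (Fin m) (MonoidAlgebra ℤ G)) :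
    Matrix (Fin n) (Fin m) (MonoidAlgebra ℂ G) :=
  B.map (MonoidAlgebra.mapRingHom G (Int.castRingHom ℂ))

/-! ## The Hilbert space `ℓ²(G)` and the Fuglede–Kadison determinant -/

section FugledeKadison

variable (G : Type*) [Group G]

/-- The Hilbert space `ℓ²(G)`. -/
abbrev L2 : Type _ := lp (fun _ : G => ℂ) 2

variable {G}

theorem summable_l2 {X : Type*} (x : L2 X) : Summable fun h => ‖x h‖ ^ (2 : ENNReal).toReal :=
  (memℓp_gen_iff (by simp)).1 (lp.memℓp x)

theorem memℓp_translate (g : G) (x : L2 G) : Memℓp (fun h : G => (x (h * g) : ℂ)) 2 :=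
  (memℓp_gen_iff (by simp)).2
    ((Equiv.mulRight g).summable_iff (f := fun h => ‖x h‖ ^ (2 : ENNReal).toReal) |>.2
      (summable_l2 x))

/-- Right translation on `ℓ²(G)`: `(x g)(h) = x (h g⁻¹)`, so that `g` sends the basis vector `h` to
the basis vector `h g`. -/
def rightTranslate (g : G) : L2 G ≃ₗᵢ[ℂ] L2 G where
  toFun x := ⟨fun h => x (h * g⁻¹), memℓp_translate g⁻¹ x⟩
  invFun x := ⟨fun h => x (h * g), memℓp_translate g x⟩
  map_add' _ _ := rfl
  map_smul' _ _ := rfl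
  left_inv x := by
    apply lp.ext
    funext h
    exact congrArg x (mul_inv_cancel_right h g)
  right_inv x := by
    apply lp.ext
    funext h
    exact congrArg x (inv_mul_cancel_right h g)
  norm_map' x := by
    rw [lp.norm_eq_tsum_rpow (by simp), lp.norm_eq_tsum_rpow (by simp)]
    congr 1
    exact (Equiv.mulRight g⁻¹).tsum_eq fun h => ‖x h‖ ^ (2 : ENNReal).toReal

theorem rightTranslate_apply (g : G) (x : L2 G) (h : G) :
    rightTranslate g x h = x (h * g⁻¹) := rfl

variable (G) in
/-- The unitary right regular action of `G` on `ℓ²(G)`. -/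
def regularAction : Gᵐᵒᵖ →* (L2 G ≃ₗᵢ[ℂ] L2 G) where
  toFun g := rightTranslate g.unop
  map_one' := by ext x h; simp [rightTranslate_apply]
  map_mul' a b := by ext x h; simp [rightTranslate_apply, mul_assoc]

/-- `(ℓ²(G))ⁿ` with its Hilbert space structure. -/
abbrev L2Pow (G : Type*) (n : ℕ) : Type _ := PiLp 2 (fun _ : Fin n => L2 G)

open scoped Classical in
/-- The vector `e_j ∈ (ℓ²(G))ⁿ` with the unit of `G` at the place `j` and `0` elsewhere. -/
def unitVec {n : ℕ} (j : Fin n) : L2Pow G n :=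
  PiLp.single 2 j (lp.single 2 (1 : G) (1 : ℂ))

/-- The von Neumann trace `∑ j, ⟨e_j, f e_j⟩`. -/
def vnTrace {n : ℕ} (f : L2Pow G n →L[ℂ] L2Pow G n) : ℂ :=
  ∑ j, inner ℂ (unitVec (G := G) j) (f (unitVec j))

/-- The operator `T* T`, where `T : (ℓ²(G))ⁿ → (ℓ²(G))ᵐ` is `x ↦ x B`. -/
def gramOp {n m : ℕ} (B : Matrix (Fin n) (Fin m) (MonoidAlgebra ℂ G)) :
    L2Pow G n →L[ℂ] L2Pow G n :=
  (matMul (regularAction G) B).adjoint ∘L matMul (regularAction G) B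

theorem gramOp_nonneg {n m : ℕ} (B : Matrix (Fin n) (Fin m) (MonoidAlgebra ℂ G)) :
    0 ≤ gramOp B :=
  (ContinuousLinearMap.nonneg_iff_isPositive _).2
    (ContinuousLinearMap.isPositive_adjoint_comp_self _)

/-- The value of the trace of the (positive) projection `P(λ)` is real; this is its real part. -/
theorem vnTrace_spectralProj_re {n : ℕ} (A : L2Pow G n →L[ℂ] L2Pow G n) (lam : ℝ) :
    (vnTrace (spectralProj A lam)).re =
      ∑ j, ‖spectralProj A lam (unitVec (G := G) j)‖ ^ 2 := by
  simp only [vnTrace, Complex.re_sum, inner_spectralProj]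

/-- The spectral density function `F_B(λ) = tr_G (P(λ))` of `B`, where `P` is the spectral family of
`T* T`. -/
def spectralDensity {n m : ℕ} (B : Matrix (Fin n) (Fin m) (MonoidAlgebra ℂ G)) :
    DensityFunction where
  toFun lam := (vnTrace (spectralProj (gramOp B) lam)).re
  mono' lam mu h := by
    simp only [vnTrace_spectralProj_re]
    exact Finset.sum_le_sum fun j _ =>
      pow_le_pow_left₀ (norm_nonneg _) (norm_spectralProj_mono _ _ h) 2
  right_continuous' lam := by
    simp only [vnTrace_spectralProj_re]
    exact tendsto_finsetSum _ fun j _ =>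
      ((spectralProj_continuousWithinAt (gramOp B) lam (unitVec j)).norm.pow 2)
  zero_of_neg' lam h := by
    simp [spectralProj_of_neg (gramOp_nonneg B) h, vnTrace]
  eventually_const' := ⟨‖gramOp B‖, fun lam h => by
    rw [spectralProj_of_norm_le (le_of_lt h), spectralProj_of_norm_le le_rfl]⟩

/-- `B` is in the determinantal class. -/
def IsDetClass {n m : ℕ} (B : Matrix (Fin n) (Fin m) (MonoidAlgebra ℂ G)) : Prop :=
  (spectralDensity B).IsDetClass

/-- The Fuglede–Kadison determinant `det_G(B) = √(det F_B)`. -/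
def fugledeKadisonDet {n m : ℕ} (B : Matrix (Fin n) (Fin m) (MonoidAlgebra ℂ G)) : ℝ :=
  √((spectralDensity B).det)

end FugledeKadison

/-! ## Finite coset spaces and the geometric determinant -/

section Cosets

variable {G : Type*} [Group G]

/-- The set `Γ\G` of right cosets `Γ x`. -/
def RightCosets (Γ : Subgroup G) : Type _ := Quotient (QuotientGroup.rightRel Γ)

/-- The right action `(Γ x) g = Γ (x g)` of `G` on `Γ\G`. -/
instance (Γ : Subgroup G) : MulAction Gᵐᵒᵖ (RightCosets Γ) where
  smul g := Quotient.map (fun x => x * g.unop) fun x y h => by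
    change QuotientGroup.rightRel Γ _ _
    have h' : QuotientGroup.rightRel Γ x y := h
    rw [QuotientGroup.rightRel_apply] at h' ⊢
    simpa [mul_assoc] using h'
  one_smul c := by
    induction c using Quotient.inductionOn with
    | h x => exact congrArg (Quotient.mk _) (mul_one x)
  mul_smul a b c := by
    induction c using Quotient.inductionOn with
    | h x => exact congrArg (Quotient.mk _) (mul_assoc x b.unop a.unop).symm

instance (Γ : Subgroup G) [Γ.FiniteIndex] : Fintype (RightCosets Γ) :=
  haveI := Fintype.ofFinite (G ⧸ Γ)
  Fintype.ofEquiv (G ⧸ Γ) (QuotientGroup.quotientRightRelEquivQuotientLeftRel Γ).symm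

/-- The unitary right action of `G` on `ℂ[Γ\G]`, in which `Γ\G` is an orthonormal basis that is
permuted by the action of `G` on `Γ\G`. -/
def cosetAction (Γ : Subgroup G) [Γ.FiniteIndex] :
    Gᵐᵒᵖ →* (EuclideanSpace ℂ (RightCosets Γ) ≃ₗᵢ[ℂ] EuclideanSpace ℂ (RightCosets Γ)) where
  toFun g := LinearIsometryEquiv.piLpCongrLeft 2 ℂ ℂ (MulAction.toPerm g)
  map_one' := by
    ext v c
    simp [LinearIsometryEquiv.piLpCongrLeft_apply, Equiv.piCongrLeft']
  map_mul' a b := by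
    ext v c
    simp [LinearIsometryEquiv.piLpCongrLeft_apply, Equiv.piCongrLeft', mul_smul]

/-- The normalized trace `tr_{Γ\G}(g)`: the trace of `g` on `ℂ[Γ\G]` divided by `[G : Γ]`. -/
def cosetTrace (Γ : Subgroup G) [Γ.FiniteIndex] (g : G) : ℂ :=
  LinearMap.trace ℂ (EuclideanSpace ℂ (RightCosets Γ))
    (cosetAction Γ (MulOpposite.op g)).toLinearEquiv.toLinearMap / (Γ.index : ℂ)

/-- The operator `B_Γ : ℂ[Γ\G]ⁿ → ℂ[Γ\G]ᵐ`, `x ↦ x B`. -/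
def cosetOp (Γ : Subgroup G) [Γ.FiniteIndex] {n m : ℕ}
    (B : Matrix (Fin n) (Fin m) (MonoidAlgebra ℂ G)) :
    PiLp 2 (fun _ : Fin n => EuclideanSpace ℂ (RightCosets Γ)) →ₗ[ℂ]
      PiLp 2 (fun _ : Fin m => EuclideanSpace ℂ (RightCosets Γ)) :=
  (matMul (cosetAction Γ) B).toLinearMap

/-- The geometric determinant `det'(f)`: the product of all nonzero singular values of `f`, with
multiplicity.  It is `1` for the zero map. -/
def geomDet {V W : Type*} [NormedAddCommGroup V] [InnerProductSpace ℂ V] [FiniteDimensional ℂ V]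
    [NormedAddCommGroup W] [InnerProductSpace ℂ W] [FiniteDimensional ℂ W] (f : V →ₗ[ℂ] W) : ℝ :=
  ∏ i ∈ f.singularValues.support, f.singularValues i

end Cosets

/-! ## Trace convergence -/

section TraceLimit

variable (G : Type*) [Group G]

/-- The set of subgroups of finite index. -/
abbrev FinIndexSubgroup : Type _ := {Γ : Subgroup G // Γ.FiniteIndex}

instance (Γ : FinIndexSubgroup G) : Γ.1.FiniteIndex := Γ.2

variable {G}

open scoped Classical in
/-- `Γ_k →^tr 1`: for every `g ∈ G`, the normalized traces `tr_{Γ_k\G}(g)` converge to `tr_G(g)`,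
which is `1` if `g = 1` and `0` otherwise. -/
def TraceConverges (Γ : ℕ → FinIndexSubgroup G) : Prop :=
  ∀ g : G, Tendsto (fun k => cosetTrace (Γ k).1 g) atTop (𝓝 (if g = 1 then 1 else 0))

/-- `limsup_{Γ →^tr 1} f(Γ)`: the infimum of all `L` such that `limsup_k f(Γ_k) ≤ L` for every
sequence with `Γ_k →^tr 1`. -/
def trLimsup (f : FinIndexSubgroup G → ℝ) : EReal :=
  sInf {L : EReal | ∀ Γ : ℕ → FinIndexSubgroup G, TraceConverges Γ →
    limsup (fun k => (f (Γ k) : EReal)) atTop ≤ L}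

end TraceLimit

end L2Det

end

noncomputable section

namespace L2Det

open Filter Topology MeasureTheory Set

/-! ## Matrices over the group ring as operators -/

section RightMul

variable {G : Type*} [Group G] {H : Type*} [NormedAddCommGroup H] [InnerProductSpace ℂ H]
  (R : Gᵐᵒᵖ →* (H ≃ₗᵢ[ℂ] H))

/-! The logarithm can be approximated from above, but not from below, by polynomials; this is why
only an upper bound for the limsup results. Let `μ` be the measure `dF`. It lives on `[0, K²]`,
where `K = matNormBound B` also bounds the norm of every `B_Γ`. Since `log` is `μ`-integrable, for
each `ε > 0` there is a polynomial `p ≥ log` on `[0, K²]` with `∫ p dμ < ∫ log dμ + 2ε`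
(`exists_polynomial_log_le`).

Summing `log ≤ p` over the eigenvalues of `B_Γ* B_Γ` gives `2 log det'(B_Γ) ≤ tr p(B_Γ* B_Γ)`
(`log_geomDet_le_trace`). With the convention `log 0 = 0`, zero eigenvalues add nothing on the left
and `p(0) ≥ 0` each on the right.

Both `T* T` and `B_Γ* B_Γ` are right multiplication by the same matrix `B * matStar B`, so traces of
their powers are fixed finite combinations of traces of group elements. Trace convergence therefore
yields `tr p(B_Γ* B_Γ) / [G : Γ] → tr_G p(T* T)` (`tendsto_trace_matMul`). The limit equals `∫ p dμ`
(`spectralDensity_measure`), which is less than `2 log det_G(B) + 2ε`. -/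

theorem rightMul_zero : rightMul R 0 = 0 := by
  simp [rightMul]

theorem rightMul_add (a b : MonoidAlgebra ℂ G) :
    rightMul R (a + b) = rightMul R a + rightMul R b := by
  unfold rightMul
  rw [MonoidAlgebra.coeff_add]
  exact Finsupp.sum_add_index' (fun _ => zero_smul _ _) fun _ _ _ => add_smul _ _ _

theorem rightMul_single (g : G) (c : ℂ) :
    rightMul R (MonoidAlgebra.single g c) =
      c • ((R (MulOpposite.op g)).toContinuousLinearEquiv : H →L[ℂ] H) := by
  unfold rightMul
  rw [MonoidAlgebra.coeff_single]
  exact Finsupp.sum_single_index (zero_smul _ _)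

theorem rightMul_single_apply (g : G) (c : ℂ) (x : H) :
    rightMul R (MonoidAlgebra.single g c) x = c • R (MulOpposite.op g) x := by
  rw [rightMul_single]
  rfl

theorem rightMul_sum {ι : Type*} (s : Finset ι) (f : ι → MonoidAlgebra ℂ G) :
    rightMul R (∑ i ∈ s, f i) = ∑ i ∈ s, rightMul R (f i) :=
  map_sum (⟨⟨rightMul R, rightMul_zero R⟩, rightMul_add R⟩ : MonoidAlgebra ℂ G →+ (H →L[ℂ] H)) f s

theorem rightMul_one : rightMul R 1 = ContinuousLinearMap.id ℂ H := by
  ext x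
  rw [MonoidAlgebra.one_def, rightMul_single_apply]
  simp

/-- The action is on the right, `x(ab) = (xa)b`, so composition reverses the order of factors. -/
theorem rightMul_mul (a b : MonoidAlgebra ℂ G) :
    rightMul R (a * b) = rightMul R b ∘L rightMul R a := by
  induction a using MonoidAlgebra.induction_linear with
  | zero => simp [rightMul_zero]
  | add a a' ha ha' => rw [add_mul, rightMul_add, ha, ha', rightMul_add, ContinuousLinearMap.comp_add]
  | single g c =>
    induction b using MonoidAlgebra.induction_linear with
    | zero => simp [rightMul_zero]
    | add b b' hb hb' =>
      rw [mul_add, rightMul_add, hb, hb', rightMul_add, ContinuousLinearMap.add_comp]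
    | single h d =>
      ext x
      rw [MonoidAlgebra.single_mul_single, ContinuousLinearMap.comp_apply]
      simp only [rightMul_single_apply, MulOpposite.op_mul, map_mul, map_smul, smul_smul]
      rw [mul_comm]
      rfl

/-- The `ℓ¹`-norm of an element of `ℂ[G]`. -/
def l1Norm (b : MonoidAlgebra ℂ G) : ℝ := b.coeff.sum fun _ c => ‖c‖

omit [Group G] in
theorem l1Norm_nonneg (b : MonoidAlgebra ℂ G) : 0 ≤ l1Norm b :=
  Finset.sum_nonneg fun _ _ => norm_nonneg _

theorem norm_rightMul_apply_le (b : MonoidAlgebra ℂ G) (x : H) :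
    ‖rightMul R b x‖ ≤ l1Norm b * ‖x‖ := by
  unfold rightMul l1Norm Finsupp.sum
  rw [sum_apply, Finset.sum_mul]
  refine (norm_sum_le _ _).trans (Finset.sum_le_sum fun g _ => ?_)
  change ‖b.coeff g • R (MulOpposite.op g) x‖ ≤ ‖b.coeff g‖ * ‖x‖
  rw [norm_smul, LinearIsometryEquiv.norm_map]

/-- The involution `∑ c_g g ↦ ∑ c̄_g g⁻¹` of `ℂ[G]`. -/
def groupStar (b : MonoidAlgebra ℂ G) : MonoidAlgebra ℂ G :=
  b.coeff.sum fun g c => MonoidAlgebra.single g⁻¹ (star c)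

theorem groupStar_single (g : G) (c : ℂ) :
    groupStar (MonoidAlgebra.single g c) = MonoidAlgebra.single g⁻¹ (star c) := by
  unfold groupStar
  rw [MonoidAlgebra.coeff_single]
  exact Finsupp.sum_single_index (by simp)

theorem groupStar_add (a b : MonoidAlgebra ℂ G) :
    groupStar (a + b) = groupStar a + groupStar b := by
  unfold groupStar
  rw [MonoidAlgebra.coeff_add]
  exact Finsupp.sum_add_index' (by simp) fun _ _ _ => by
    rw [star_add, MonoidAlgebra.single_add]

/-- Each `g` acts unitarily, so its adjoint is the action of `g⁻¹`; scalars are conjugated. -/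
theorem inner_rightMul_groupStar (b : MonoidAlgebra ℂ G) (x y : H) :
    inner ℂ (rightMul R (groupStar b) x) y = inner ℂ x (rightMul R b y) := by
  induction b using MonoidAlgebra.induction_linear with
  | zero => simp [groupStar, rightMul_zero]
  | add a b ha hb =>
    rw [groupStar_add, rightMul_add, rightMul_add, add_apply, add_apply, inner_add_left,
      inner_add_right, ha, hb]
  | single g c =>
    rw [groupStar_single, rightMul_single_apply, rightMul_single_apply, inner_smul_left,
      inner_smul_right, ← LinearIsometryEquiv.inner_map_map (R (MulOpposite.op g)) _ y]
    have h : R (MulOpposite.op g) (R (MulOpposite.op g⁻¹) x) = x := by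
      change (R (MulOpposite.op g) * R (MulOpposite.op g⁻¹)) x = x
      rw [← map_mul, ← MulOpposite.op_mul, inv_mul_cancel, MulOpposite.op_one, map_one]
      rfl
    rw [h]
    simp

variable {n m k : ℕ}

theorem matMul_apply (B : Matrix (Fin n) (Fin m) (MonoidAlgebra ℂ G))
    (x : PiLp 2 (fun _ : Fin n => H)) (j : Fin m) :
    matMul R B x j = ∑ i, rightMul R (B i j) (x i) := by
  simp [matMul]

theorem matMul_mul (B : Matrix (Fin n) (Fin m) (MonoidAlgebra ℂ G))
    (C : Matrix (Fin m) (Fin k) (MonoidAlgebra ℂ G)) :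
    matMul R (B * C) = matMul R C ∘L matMul R B := by
  ext x l
  simp only [ContinuousLinearMap.comp_apply, matMul_apply, Matrix.mul_apply, rightMul_sum,
    rightMul_mul, sum_apply, map_sum]
  exact Finset.sum_comm

theorem matMul_one :
    matMul R (1 : Matrix (Fin n) (Fin n) (MonoidAlgebra ℂ G)) = 1 := by
  ext x j
  rw [matMul_apply, Finset.sum_eq_single j]
  · simp [rightMul_one]
  · intro i _ hij
    simp [Matrix.one_apply_ne hij, rightMul_zero]
  · simp

theorem matMul_pow (D : Matrix (Fin n) (Fin n) (MonoidAlgebra ℂ G)) (k : ℕ) :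
    matMul R (D ^ k) = matMul R D ^ k := by
  induction k with
  | zero => rw [pow_zero, pow_zero, matMul_one]
  | succ k ih => rw [pow_succ, matMul_mul, ih, pow_succ']; rfl

/-- The conjugate transpose of a matrix over `ℂ[G]`. -/
def matStar (B : Matrix (Fin n) (Fin m) (MonoidAlgebra ℂ G)) :
    Matrix (Fin m) (Fin n) (MonoidAlgebra ℂ G) :=
  Matrix.of fun j i => groupStar (B i j)

/-- Adjoints are computed inside the group ring, independently of the representation. This makes the
operators on `ℓ²(G)` and on the finite quotients comparable. -/
theorem adjoint_matMul [CompleteSpace H] (B : Matrix (Fin n) (Fin m) (MonoidAlgebra ℂ G)) :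
    (matMul R B).adjoint = matMul R (matStar B) := by
  symm
  rw [ContinuousLinearMap.eq_adjoint_iff]
  intro x y
  simp only [PiLp.inner_apply, matMul_apply, matStar, Matrix.of_apply, sum_inner, inner_sum,
    inner_rightMul_groupStar]
  exact Finset.sum_comm

/-- A bound for the norm of `x ↦ x B` that does not depend on the representation. -/
def matNormBound (B : Matrix (Fin n) (Fin m) (MonoidAlgebra ℂ G)) : ℝ :=
  ∑ j, ∑ i, l1Norm (B i j)

omit [Group G] in
theorem matNormBound_nonneg (B : Matrix (Fin n) (Fin m) (MonoidAlgebra ℂ G)) :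
    0 ≤ matNormBound B :=
  Finset.sum_nonneg fun _ _ => Finset.sum_nonneg fun _ _ => l1Norm_nonneg _

theorem norm_matMul_le (B : Matrix (Fin n) (Fin m) (MonoidAlgebra ℂ G)) :
    ‖matMul R B‖ ≤ matNormBound B := by
  refine ContinuousLinearMap.opNorm_le_bound _ (matNormBound_nonneg B) fun x => ?_
  -- Splitting into coordinate vectors loses sharpness, but only a bound uniform in `R` is needed.
  have h1 : matMul R B x = ∑ j, PiLp.single 2 j (matMul R B x j) := by
    ext l
    simp [WithLp.ofLp_sum, PiLp.ofLp_single, Finset.sum_apply, Pi.single_apply]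
  rw [h1, matNormBound, Finset.sum_mul]
  refine (norm_sum_le _ _).trans (Finset.sum_le_sum fun j _ => ?_)
  rw [PiLp.norm_single, matMul_apply, Finset.sum_mul]
  refine (norm_sum_le _ _).trans (Finset.sum_le_sum fun i _ => ?_)
  exact (norm_rightMul_apply_le R _ _).trans
    (mul_le_mul_of_nonneg_left (PiLp.norm_apply_le x i) (l1Norm_nonneg _))

theorem trace_matMul [FiniteDimensional ℂ H]
    (E : Matrix (Fin n) (Fin n) (MonoidAlgebra ℂ G)) :
    LinearMap.trace ℂ _ (matMul R E).toLinearMap =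
      ∑ j, LinearMap.trace ℂ H (rightMul R (E j j)).toLinearMap := by
  let b := stdOrthonormalBasis ℂ H
  let b' : OrthonormalBasis (Σ _ : Fin n, Fin (Module.finrank ℂ H)) ℂ
      (PiLp 2 (fun _ : Fin n => H)) := Pi.orthonormalBasis fun _ => b
  rw [LinearMap.trace_eq_sum_inner _ b', Fintype.sum_sigma]
  refine Finset.sum_congr rfl fun j _ => ?_
  rw [LinearMap.trace_eq_sum_inner _ b]
  refine Finset.sum_congr rfl fun l _ => ?_
  simp only [b', Pi.orthonormalBasis_apply, ContinuousLinearMap.coe_coe]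
  rw [PiLp.inner_apply, Finset.sum_eq_single j]
  · rw [matMul_apply, Finset.sum_eq_single j]
    · simp
    · intro i _ hij
      simp [hij]
    · simp
  · intro i _ hij
    simp [hij]
  · simp

theorem trace_rightMul (b : MonoidAlgebra ℂ G) :
    LinearMap.trace ℂ H (rightMul R b).toLinearMap =
      b.coeff.sum fun g c => c *
        LinearMap.trace ℂ H (R (MulOpposite.op g)).toLinearEquiv.toLinearMap := by
  unfold rightMul Finsupp.sum
  rw [ContinuousLinearMap.toLinearMap_sum, map_sum]
  refine Finset.sum_congr rfl fun g _ => ?_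
  rw [ContinuousLinearMap.toLinearMap_smul, map_smul, smul_eq_mul]
  rfl

end RightMul

/-! ### Traces of group ring matrices and their limits -/

section Trace

variable {G : Type*} [Group G] {n m : ℕ}

open scoped Classical in
theorem inner_unit_regularAction (g : G) :
    inner ℂ (lp.single 2 (1 : G) (1 : ℂ) : L2 G)
      (regularAction G (MulOpposite.op g) (lp.single 2 (1 : G) (1 : ℂ))) =
      if g = 1 then 1 else 0 := by
  rw [lp.inner_single_left]
  change inner ℂ (1 : ℂ) ((lp.single 2 (1 : G) (1 : ℂ) : L2 G) (1 * g⁻¹)) = _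
  rw [lp.single_apply, Pi.single_apply]
  simp

open scoped Classical in
theorem inner_unit_rightMul (b : MonoidAlgebra ℂ G) :
    inner ℂ (lp.single 2 (1 : G) (1 : ℂ) : L2 G)
      (rightMul (regularAction G) b (lp.single 2 (1 : G) (1 : ℂ))) =
      b.coeff.sum fun g c => c * if g = 1 then 1 else 0 := by
  unfold rightMul Finsupp.sum
  rw [sum_apply, inner_sum]
  refine Finset.sum_congr rfl fun g _ => ?_
  exact (inner_smul_right _ _ _).trans (congrArg _ (inner_unit_regularAction g))

open scoped Classical in
theorem vnTrace_matMul (E : Matrix (Fin n) (Fin n) (MonoidAlgebra ℂ G)) :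
    vnTrace (matMul (regularAction G) E) =
      ∑ j, (E j j).coeff.sum fun g c => c * if g = 1 then 1 else 0 := by
  unfold vnTrace
  refine Finset.sum_congr rfl fun j _ => ?_
  rw [← inner_unit_rightMul, PiLp.inner_apply, Finset.sum_eq_single j]
  · rw [matMul_apply, Finset.sum_eq_single j]
    · simp [unitVec]
    · intro i _ hij
      simp [unitVec, hij]
    · simp
  · intro i _ hij
    simp [unitVec, hij]
  · simp

/-- Only finitely many group elements occur on the diagonal of `E`, and both traces are linear in
their coefficients, so convergence for each single `g` suffices. -/
theorem tendsto_trace_matMul {Γ : ℕ → FinIndexSubgroup G} (hΓ : TraceConverges Γ)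
    (E : Matrix (Fin n) (Fin n) (MonoidAlgebra ℂ G)) :
    Tendsto (fun k => LinearMap.trace ℂ _ (matMul (cosetAction (Γ k).1) E).toLinearMap /
      ((Γ k).1.index : ℂ)) atTop (𝓝 (vnTrace (matMul (regularAction G) E))) := by
  classical
  rw [vnTrace_matMul]
  simp only [trace_matMul, trace_rightMul, Finsupp.sum, Finset.sum_div, mul_div_assoc]
  refine tendsto_finsetSum _ fun j _ => tendsto_finsetSum _ fun g _ => ?_
  refine (Tendsto.const_mul _ ?_)
  exact hΓ g

end Trace

/-! ## The spectral density function as a spectral measure -/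

section SpectralMeasure

variable {H : Type*} [NormedAddCommGroup H] [InnerProductSpace ℂ H] [CompleteSpace H]

/-- A continuous cut-off function, `1` on `(-∞, lam]` and `0` on `[lam + 1 / N, ∞)`. -/
def cutoff (lam : ℝ) (N : ℕ) (t : ℝ) : ℝ := max 0 (1 - N * max (t - lam) 0)

theorem continuous_cutoff (lam : ℝ) (N : ℕ) : Continuous (cutoff lam N) := by
  unfold cutoff
  fun_prop

theorem cutoff_nonneg (lam : ℝ) (N : ℕ) (t : ℝ) : 0 ≤ cutoff lam N t := le_max_left _ _

theorem cutoff_le_one (lam : ℝ) (N : ℕ) (t : ℝ) : cutoff lam N t ≤ 1 :=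
  max_le zero_le_one (sub_le_self _ (by positivity))

theorem norm_cutoff_le_one (lam : ℝ) (N : ℕ) (t : ℝ) : ‖cutoff lam N t‖ ≤ 1 := by
  rw [Real.norm_of_nonneg (cutoff_nonneg _ _ _)]
  exact cutoff_le_one _ _ _

theorem cutoff_mul_le (lam : ℝ) {N : ℕ} (hN : 0 < N) (t : ℝ) :
    ‖cutoff lam N t * max (t - lam) 0‖ ≤ 1 / N := by
  have hN' : (0 : ℝ) < N := by exact_mod_cast hN
  have hs : 0 ≤ max (t - lam) 0 := le_max_right _ _
  rw [Real.norm_of_nonneg (mul_nonneg (cutoff_nonneg _ _ _) hs), le_div_iff₀ hN']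
  rcases le_total (1 - N * max (t - lam) 0) 0 with h | h
  · rw [cutoff, max_eq_left h]
    simp
  · have := cutoff_le_one lam N t
    have h0 := cutoff_nonneg lam N t
    nlinarith

theorem tendsto_cutoff (lam t : ℝ) :
    Tendsto (fun N => cutoff lam N t) atTop (𝓝 ((Iic lam).indicator 1 t)) := by
  by_cases ht : t ≤ lam
  · simp [cutoff, ht]
  · have hs : 0 < t - lam := by linarith
    rw [indicator_of_notMem (by simpa using ht)]
    refine tendsto_const_nhds.congr' ?_
    filter_upwards [eventually_ge_atTop ⌈(t - lam)⁻¹⌉₊] with N hN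
    have h1 : (t - lam)⁻¹ ≤ N := (Nat.le_ceil _).trans (by exact_mod_cast hN)
    rw [cutoff, max_eq_left hs.le, max_eq_left]
    have := mul_le_mul_of_nonneg_right h1 hs.le
    rw [inv_mul_cancel₀ hs.ne'] at this
    linarith

/-- With `s = (t - lam)⁺`, the cut-off equals `1 - h s` for the continuous function `h = N / max 1
(N s)`, so `1 - cutoff` factors through `posPartSub A lam`. -/
theorem cfc_cutoff_of_mem_ker {A : H →L[ℂ] H} (hA : IsSelfAdjoint A) (lam : ℝ) (N : ℕ) {p : H}
    (hp : posPartSub A lam p = 0) : cfc (cutoff lam N) A p = p := by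
  have hpos : ∀ t : ℝ, 0 < max 1 (N * max (t - lam) 0) := fun t =>
    lt_of_lt_of_le one_pos (le_max_left _ _)
  have hc : Continuous fun t : ℝ => (N : ℝ) / max 1 (N * max (t - lam) 0) :=
    Continuous.div (by fun_prop) (by fun_prop) fun t => (hpos t).ne'
  have key : cfc (cutoff lam N) A =
      1 - cfc (fun t : ℝ => (N : ℝ) / max 1 (N * max (t - lam) 0)) A * posPartSub A lam := by
    unfold posPartSub
    rw [← cfc_mul _ _ A hc.continuousOn (by fun_prop), ← cfc_const_one ℝ A,
      ← cfc_sub (fun _ => 1) (fun t : ℝ => (N : ℝ) / max 1 (N * max (t - lam) 0) *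
        max (t - lam) 0) A (by fun_prop) (hc.continuousOn.mul (by fun_prop))]
    congr 1
    funext t
    unfold cutoff
    rw [div_mul_eq_mul_div]
    rcases le_total (N * max (t - lam) 0) 1 with h | h
    · rw [max_eq_left h, max_eq_right (by linarith), div_one]
    · rw [max_eq_right h, max_eq_left (by linarith), div_self (by linarith), sub_self]
  rw [key, sub_apply, mul_apply_eq_comp, hp, map_zero, sub_zero]
  rfl

/-- The cut-offs fix the kernel of `(A - lam)⁺`. Its orthogonal complement is the closure of the
range, and on a range vector `(A - lam)⁺ z` the cut-off has norm at most `‖z‖ / N`. -/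
theorem tendsto_cfc_cutoff {A : H →L[ℂ] H} (hA : IsSelfAdjoint A) (lam : ℝ) (x : H) :
    Tendsto (fun N => cfc (cutoff lam N) A x) atTop (𝓝 (spectralProj A lam x)) := by
  rw [Metric.tendsto_atTop]
  intro ε hε
  set p := spectralProj A lam x with hp
  have hpmem : p ∈ (posPartSub A lam).ker := Submodule.starProjection_apply_mem _ _
  have hy : x - p ∈ (posPartSub A lam).rangeᗮᗮ := by
    rw [ContinuousLinearMap.orthogonal_range,
      ← ContinuousLinearMap.star_eq_adjoint, (posPartSub_isSelfAdjoint A lam).star_eq]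
    exact Submodule.sub_starProjection_mem_orthogonal _
  rw [Submodule.orthogonal_orthogonal_eq_closure] at hy
  obtain ⟨_, ⟨z, rfl⟩, hz⟩ := Metric.mem_closure_iff.1 hy (ε / 2) (by positivity)
  obtain ⟨N₀, hN₀⟩ := exists_nat_gt (‖z‖ / (ε / 2))
  refine ⟨N₀ + 1, fun N hN => ?_⟩
  have hNpos : 0 < N := by omega
  have hN' : (0 : ℝ) < N := by exact_mod_cast hNpos
  have hsplit : cfc (cutoff lam N) A x - p =
      cfc (cutoff lam N) A ((x - p) - posPartSub A lam z) +
        (cfc (cutoff lam N) A * posPartSub A lam) z := by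
    rw [map_sub, map_sub, cfc_cutoff_of_mem_ker hA lam N hpmem, mul_apply_eq_comp]
    abel
  have e1 := (cfc (cutoff lam N) A).le_of_opNorm_le
    (norm_cfc_le zero_le_one fun t _ => norm_cutoff_le_one lam N t) ((x - p) - posPartSub A lam z)
  have e2 : ‖cfc (cutoff lam N) A * posPartSub A lam‖ ≤ 1 / N := by
    unfold posPartSub
    rw [← cfc_mul _ _ A (continuous_cutoff lam N).continuousOn (by fun_prop)]
    exact norm_cfc_le (by positivity) fun t _ => cutoff_mul_le lam hNpos t
  have e3 := (cfc (cutoff lam N) A * posPartSub A lam).le_of_opNorm_le e2 z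
  have e4 : ‖(x - p) - posPartSub A lam z‖ < ε / 2 := by
    rw [← dist_eq_norm]; exact hz
  have e5 : 1 / (N : ℝ) * ‖z‖ ≤ ε / 2 := by
    rw [one_div, inv_mul_le_iff₀ hN']
    rw [div_lt_iff₀ (by positivity)] at hN₀
    have : (N₀ : ℝ) ≤ N := by exact_mod_cast (by omega : N₀ ≤ N)
    nlinarith
  rw [dist_eq_norm, hsplit]
  calc _ ≤ _ := norm_add_le _ _
    _ < ε := by linarith

/-- The positive functional `f ↦ ∑ i, ⟨e i, f(A) (e i)⟩` on continuous functions on the spectrum. -/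
def spectralFunctional {A : H →L[ℂ] H} (hA : IsSelfAdjoint A) {n : ℕ} (e : Fin n → H) :
    CompactlySupportedContinuousMap (spectrum ℝ A) ℝ →ₚ[ℝ] ℝ :=
  PositiveLinearMap.mk₀
    { toFun := fun f => ∑ i, (inner ℂ (e i) (cfcHom (R := ℝ) hA f.toContinuousMap (e i))).re
      map_add' := fun f g => by
        have : (f + g).toContinuousMap = f.toContinuousMap + g.toContinuousMap := rfl
        simp only [this, map_add, add_apply, inner_add_right, Complex.add_re,
          Finset.sum_add_distrib]
      map_smul' := fun c f => by
        have : (c • f).toContinuousMap = c • f.toContinuousMap := rfl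
        simp only [this, map_smul, RingHom.id_apply, smul_eq_mul, Finset.mul_sum]
        refine Finset.sum_congr rfl fun i _ => ?_
        rw [← Complex.coe_smul, smul_apply, inner_smul_right, Complex.re_ofReal_mul] }
    fun f hf => by
      have h : 0 ≤ cfcHom (R := ℝ) hA f.toContinuousMap :=
        (cfcHom_nonneg_iff hA).2 hf
      change 0 ≤ ∑ i, (inner ℂ (e i) (cfcHom (R := ℝ) hA f.toContinuousMap (e i))).re
      exact Finset.sum_nonneg fun i _ =>
        ((ContinuousLinearMap.nonneg_iff_isPositive _).1 h).re_inner_nonneg_right (e i)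

/-- Riesz–Markov on the compact spectrum, where every continuous function has compact support,
followed by push-forward to `ℝ`. -/
theorem exists_spectralMeasure {A : H →L[ℂ] H} (hA : IsSelfAdjoint A) {n : ℕ} (e : Fin n → H) :
    ∃ ν : Measure ℝ, IsFiniteMeasure ν ∧ (∀ᵐ t ∂ν, t ∈ spectrum ℝ A) ∧
      ∀ f : ℝ → ℝ, Continuous f → ∫ t, f t ∂ν = ∑ i, (inner ℂ (e i) (cfc f A (e i))).re := by
  have hK : IsCompact (spectrum ℝ A) := ContinuousFunctionalCalculus.isCompact_spectrum A
  have : CompactSpace (spectrum ℝ A) := isCompact_iff_compactSpace.1 hK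
  refine ⟨(RealRMK.rieszMeasure (spectralFunctional hA e)).map Subtype.val, ?_, ?_, ?_⟩
  · infer_instance
  · refine (ae_map_iff measurable_subtype_coe.aemeasurable hK.measurableSet).2 ?_
    exact Eventually.of_forall fun t => t.2
  · intro f hf
    rw [integral_map measurable_subtype_coe.aemeasurable hf.aestronglyMeasurable]
    have h := RealRMK.integral_rieszMeasure (spectralFunctional hA e)
      ⟨⟨fun t => f t, hf.comp continuous_subtype_val⟩, HasCompactSupport.of_compactSpace _⟩
    refine h.trans ?_
    rw [cfc_apply f A hA hf.continuousOn]
    rfl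

/-- Pass to the limit along the cut-offs: by dominated convergence in the integrals, by strong
convergence in the inner products. -/
theorem spectralMeasure_Iic {A : H →L[ℂ] H} (hA : IsSelfAdjoint A) {n : ℕ} (e : Fin n → H)
    (ν : Measure ℝ) [IsFiniteMeasure ν]
    (hν : ∀ f : ℝ → ℝ, Continuous f → ∫ t, f t ∂ν = ∑ i, (inner ℂ (e i) (cfc f A (e i))).re)
    (lam : ℝ) :
    ν.real (Iic lam) = ∑ i, (inner ℂ (e i) (spectralProj A lam (e i))).re := by
  have h1 : Tendsto (fun N => ∫ t, cutoff lam N t ∂ν) atTop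
      (𝓝 (∫ t, (Iic lam).indicator 1 t ∂ν)) :=
    tendsto_integral_of_dominated_convergence (fun _ => 1)
      (fun N => (continuous_cutoff lam N).aestronglyMeasurable) (integrable_const _)
      (fun N => Eventually.of_forall fun t => norm_cutoff_le_one lam N t)
      (Eventually.of_forall fun t => tendsto_cutoff lam t)
  rw [integral_indicator_one measurableSet_Iic] at h1
  refine tendsto_nhds_unique h1 ?_
  simp only [hν _ (continuous_cutoff lam _)]
  exact tendsto_finsetSum _ fun i _ =>
    (Complex.continuous_re.tendsto _).comp (tendsto_const_nhds.inner (tendsto_cfc_cutoff hA lam (e i)))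

omit [CompleteSpace H] in
theorem aeval_inner_re (A : H →L[ℂ] H) (p : Polynomial ℝ) (x : H) :
    (inner ℂ x (Polynomial.aeval A p x)).re =
      p.sum fun k c => c * (inner ℂ x ((A ^ k) x)).re := by
  rw [Polynomial.aeval_eq_sum_range, Polynomial.sum_over_range _ (by simp), sum_apply, inner_sum,
    Complex.re_sum]
  refine Finset.sum_congr rfl fun k _ => ?_
  rw [smul_apply, ← Complex.coe_smul, inner_smul_right, Complex.re_ofReal_mul]

theorem exists_measure_of_nonneg {A : H →L[ℂ] H} (hA : 0 ≤ A) {n : ℕ} (e : Fin n → H) :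
    ∃ ν : Measure ℝ, IsFiniteMeasure ν ∧ (∀ᵐ t ∂ν, t ∈ Icc 0 ‖A‖) ∧
      (∀ lam, ν.real (Iic lam) = ∑ i, (inner ℂ (e i) (spectralProj A lam (e i))).re) ∧
      ∀ p : Polynomial ℝ, ∫ t, p.eval t ∂ν =
        p.sum fun k c => c * ∑ i, (inner ℂ (e i) ((A ^ k) (e i))).re := by
  have hsa : IsSelfAdjoint A := IsSelfAdjoint.of_nonneg hA
  obtain ⟨ν, hfin, hsupp, hν⟩ := exists_spectralMeasure hsa e
  refine ⟨ν, hfin, ?_, spectralMeasure_Iic hsa e ν hν, fun p => ?_⟩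
  · filter_upwards [hsupp] with t ht
    refine ⟨spectrum_nonneg_of_nonneg hA ht, ?_⟩
    have h1 : ‖t‖ ≤ ‖A‖ * ‖(1 : H →L[ℂ] H)‖ := spectrum.norm_le_norm_mul_of_mem ht
    have h2 : ‖(1 : H →L[ℂ] H)‖ ≤ 1 := ContinuousLinearMap.norm_id_le
    have h3 : t ≤ ‖t‖ := Real.le_norm_self t
    nlinarith [norm_nonneg A]
  · rw [hν _ p.continuous, cfc_polynomial p A]
    simp only [aeval_inner_re, Polynomial.sum, Finset.mul_sum]
    exact Finset.sum_comm

end SpectralMeasure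

/-! ### The measure of the spectral density function -/

theorem DensityFunction.tendsto_atBot (F : DensityFunction) :
    Tendsto F.toStieltjesFunction atBot (𝓝 0) :=
  tendsto_const_nhds.congr' <| by
    filter_upwards [eventually_lt_atBot 0] with x hx
    exact (F.zero_of_neg' x hx).symm

section Group

variable {G : Type*} [Group G] {n m : ℕ}

theorem spectralDensity_measure (B : Matrix (Fin n) (Fin m) (MonoidAlgebra ℂ G)) :
    IsFiniteMeasure (spectralDensity B).toStieltjesFunction.measure ∧
    (∀ᵐ t ∂(spectralDensity B).toStieltjesFunction.measure, t ∈ Icc 0 ‖gramOp B‖) ∧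
    ∀ p : Polynomial ℝ, ∫ t, p.eval t ∂(spectralDensity B).toStieltjesFunction.measure =
      p.sum fun k c => c * (vnTrace (gramOp B ^ k)).re := by
  obtain ⟨ν, hfin, hsupp, hIic, hν⟩ :=
    exists_measure_of_nonneg (gramOp_nonneg B) fun j : Fin n => unitVec (G := G) j
  have hF : ν = (spectralDensity B).toStieltjesFunction.measure := by
    -- As `F` vanishes at `-∞`, its Stieltjes measure has distribution function `F`, including the
    -- atom `F(0)` at `0`; finite measures with equal distribution functions agree.
    refine Measure.ext_of_Iic _ _ fun lam => ?_
    rw [StieltjesFunction.measure_Iic _ (spectralDensity B).tendsto_atBot, sub_zero,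
      ← ofReal_measureReal, hIic]
    congr 1
    exact (Complex.re_sum _ _).symm
  rw [← hF]
  refine ⟨hfin, hsupp, fun p => (hν p).trans ?_⟩
  simp only [vnTrace, Complex.re_sum]

end Group

/-! ## Polynomial majorants of the logarithm -/

/-- A continuous function on `[0, ∞)` that agrees with `log` on `[δ, ∞)` and is linear on
`[0, δ]`. -/
def truncLog (δ t : ℝ) : ℝ := Real.log (max t δ) * min 1 (t / δ)

theorem continuous_truncLog {δ : ℝ} (hδ : 0 < δ) : Continuous (truncLog δ) := by
  unfold truncLog
  refine Continuous.mul (Continuous.log (by fun_prop) fun t => ?_) (by fun_prop)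
  exact (lt_of_lt_of_le hδ (le_max_right _ _)).ne'

theorem truncLog_of_le {δ t : ℝ} (hδ : 0 < δ) (h : δ ≤ t) : truncLog δ t = Real.log t := by
  rw [truncLog, max_eq_left h, min_eq_left ((one_le_div₀ hδ).2 h), mul_one]

theorem truncLog_of_ge {δ t : ℝ} (hδ : 0 < δ) (h : t ≤ δ) :
    truncLog δ t = Real.log δ * (t / δ) := by
  rw [truncLog, max_eq_right h, min_eq_right ((div_le_one₀ hδ).2 h)]

/-- For `0 < t ≤ δ ≤ 1`, `log t ≤ log δ ≤ (t / δ) log δ` because `log δ ≤ 0`; at `t = 0` both sides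
are `0`. -/
theorem log_le_truncLog {δ t : ℝ} (hδ : 0 < δ) (hδ1 : δ ≤ 1) (ht : 0 ≤ t) :
    Real.log t ≤ truncLog δ t := by
  rcases le_total δ t with h | h
  · rw [truncLog_of_le hδ h]
  · rw [truncLog_of_ge hδ h]
    rcases ht.eq_or_lt with rfl | ht
    · simp
    · have h1 := Real.log_le_log ht h
      have h2 := Real.log_nonpos hδ.le hδ1
      have h3 : t / δ ≤ 1 := (div_le_one₀ hδ).2 h
      nlinarith

theorem norm_truncLog_le {δ t : ℝ} (hδ : 0 < δ) (hδ1 : δ ≤ 1) (ht : 0 ≤ t) :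
    ‖truncLog δ t‖ ≤ ‖Real.log t‖ := by
  rcases le_total δ t with h | h
  · rw [truncLog_of_le hδ h]
  · have h1 := log_le_truncLog hδ hδ1 ht
    have h2 : truncLog δ t ≤ 0 := by
      rw [truncLog_of_ge hδ h]
      exact mul_nonpos_of_nonpos_of_nonneg (Real.log_nonpos hδ.le hδ1) (by positivity)
    rw [Real.norm_of_nonpos h2, Real.norm_of_nonpos (h1.trans h2)]
    linarith

/-- The truncations `truncLog δ` are continuous majorants of `log` and are dominated by `|log|`, so
their integrals tend to `∫ log dν` as `δ → 0`. A Weierstrass approximation of one of them, raised by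
its error, remains a majorant. -/
theorem exists_polynomial_log_le (ν : Measure ℝ) [IsFiniteMeasure ν] {C : ℝ}
    (hsupp : ∀ᵐ t ∂ν, t ∈ Icc 0 C) (hint : Integrable Real.log ν) {ε : ℝ} (hε : 0 < ε) :
    ∃ p : Polynomial ℝ, (∀ t ∈ Icc 0 C, Real.log t ≤ p.eval t) ∧
      ∫ t, p.eval t ∂ν < ∫ t, Real.log t ∂ν + ε := by
  have hlim : Tendsto (fun N : ℕ => ∫ t, truncLog (1 / ((N : ℝ) + 1)) t ∂ν) atTop
      (𝓝 (∫ t, Real.log t ∂ν)) := by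
    have hle : ∀ N : ℕ, 1 / ((N : ℝ) + 1) ≤ 1 := fun N =>
      (div_le_one₀ (by positivity)).2 (by linarith [N.cast_nonneg (α := ℝ)])
    refine tendsto_integral_of_dominated_convergence (fun t => ‖Real.log t‖)
      (fun N => (continuous_truncLog (by positivity)).aestronglyMeasurable) hint.norm
      (fun N => ?_) ?_
    · filter_upwards [hsupp] with t ht
      exact norm_truncLog_le (by positivity) (hle N) ht.1
    · filter_upwards [hsupp] with t ht
      rcases ht.1.eq_or_lt with rfl | h0
      · simp [truncLog]
      · refine tendsto_const_nhds.congr' ?_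
        filter_upwards [(tendsto_one_div_add_atTop_nhds_zero_nat (𝕜 := ℝ)).eventually_le_const h0]
          with N hN
        exact (truncLog_of_le (by positivity) hN).symm
  obtain ⟨N, hN⟩ := (hlim.eventually_lt_const (lt_add_of_pos_right _ (half_pos hε))).exists
  set δ : ℝ := 1 / ((N : ℝ) + 1) with hδdef
  have hδ : 0 < δ := by positivity
  have hδ1 : δ ≤ 1 := (div_le_one₀ (by positivity)).2 (by linarith [N.cast_nonneg (α := ℝ)])
  -- The shifted polynomial exceeds `truncLog δ` by at most `2η`, costing at most `ε / 2` in the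
  -- integral; the `+ 1` covers `ν = 0`.
  set η : ℝ := ε / (4 * (ν.real univ + 1)) with hη
  have hmass : 0 ≤ ν.real univ := measureReal_nonneg
  have hηpos : 0 < η := by positivity
  obtain ⟨q, hq⟩ := exists_polynomial_near_of_continuousOn 0 C (truncLog δ)
    (continuous_truncLog hδ).continuousOn η hηpos
  have hbdd : ∀ {f : ℝ → ℝ}, Continuous f → Integrable f ν := by
    intro f hf
    obtain ⟨K, hK⟩ := isCompact_Icc.exists_bound_of_continuousOn (s := Icc 0 C) hf.continuousOn
    exact Integrable.of_bound hf.aestronglyMeasurable K (hsupp.mono hK)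
  refine ⟨q + Polynomial.C η, fun t ht => ?_, ?_⟩
  · have h1 := (abs_lt.1 (hq t ht)).1
    have h2 := log_le_truncLog hδ hδ1 ht.1
    rw [Polynomial.eval_add, Polynomial.eval_C]
    linarith
  · have h1 : ∫ t, (q + Polynomial.C η).eval t ∂ν ≤ ∫ t, (truncLog δ t + 2 * η) ∂ν := by
      refine integral_mono_ae (hbdd (Polynomial.continuous _))
        (hbdd ((continuous_truncLog hδ).add continuous_const)) ?_
      filter_upwards [hsupp] with t ht
      have h1 := (abs_lt.1 (hq t ht)).2
      rw [Polynomial.eval_add, Polynomial.eval_C]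
      linarith
    rw [integral_add (hbdd (continuous_truncLog hδ)) (integrable_const _), integral_const,
      smul_eq_mul] at h1
    have h2 : ν.real univ * (2 * η) ≤ ε / 2 := by
      rw [hη, ← mul_div_assoc, ← mul_div_assoc, div_le_iff₀ (by positivity)]
      nlinarith
    linarith

/-! ## Geometric determinants and traces of powers -/

section GeomDet

variable {V W : Type*} [NormedAddCommGroup V] [InnerProductSpace ℂ V] [FiniteDimensional ℂ V]
    [NormedAddCommGroup W] [InnerProductSpace ℂ W] [FiniteDimensional ℂ W]

theorem trace_pow_eq_sum_eigenvalues {S : V →ₗ[ℂ] V} (hS : S.IsSymmetric) (k : ℕ) :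
    LinearMap.trace ℂ V (S ^ k) = ∑ i, ((hS.eigenvalues rfl i ^ k : ℝ) : ℂ) := by
  rw [LinearMap.trace_eq_sum_inner _ (hS.eigenvectorBasis rfl)]
  refine Finset.sum_congr rfl fun i _ => ?_
  have h : (S ^ k) (hS.eigenvectorBasis rfl i) =
      ((hS.eigenvalues rfl i ^ k : ℝ) : ℂ) • hS.eigenvectorBasis rfl i := by
    induction k with
    | zero => simp
    | succ k ih =>
      rw [pow_succ', Module.End.mul_apply, ih, map_smul, hS.apply_eigenvectorBasis rfl i, smul_smul]
      push_cast
      rw [pow_succ]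
      rfl
  rw [h, inner_smul_right]
  simp

/-- The eigenvalues are the squares of the singular values. Because `Real.log 0 = 0`, the sum may
run over all of them, kernel included. -/
theorem log_geomDet (f : V →ₗ[ℂ] W) :
    2 * Real.log (geomDet f) =
      ∑ i, Real.log (f.isSymmetric_adjoint_comp_self.eigenvalues rfl i) := by
  have h1 : Real.log (geomDet f) =
      ∑ i ∈ Finset.range (Module.finrank ℂ V), Real.log (f.singularValues i) := by
    unfold geomDet
    rw [Real.log_prod fun i hi => Finsupp.mem_support_iff.1 hi]
    refine Finset.sum_subset (fun i hi => ?_) fun i _ hi => ?_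
    · rw [Finset.mem_range]
      by_contra! h
      exact Finsupp.mem_support_iff.1 hi (f.singularValues_of_finrank_le h)
    · rw [Finsupp.notMem_support_iff.1 hi, Real.log_zero]
  rw [h1, Finset.sum_range, Finset.mul_sum]
  refine Finset.sum_congr rfl fun i _ => ?_
  rw [← f.sq_singularValues_fin rfl i, Real.log_pow]
  norm_num

theorem eigenvalues_adjoint_comp_self_mem_Icc (f : V →ₗ[ℂ] W) {K : ℝ}
    (hK : ∀ x, ‖f x‖ ≤ K * ‖x‖) (i : Fin (Module.finrank ℂ V)) :
    f.isSymmetric_adjoint_comp_self.eigenvalues rfl i ∈ Icc 0 (K ^ 2) := by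
  refine ⟨f.isPositive_adjoint_comp_self.nonneg_eigenvalues rfl i, ?_⟩
  set b := f.isSymmetric_adjoint_comp_self.eigenvectorBasis rfl with hb
  -- The eigenvalue at the unit eigenvector `b i` is its Rayleigh quotient `‖f (b i)‖²`.
  have h1 : ((‖f (b i)‖ ^ 2 : ℝ) : ℂ) =
      ((f.isSymmetric_adjoint_comp_self.eigenvalues rfl i : ℝ) : ℂ) := by
    have h2 : inner ℂ (b i) ((f.adjoint ∘ₗ f) (b i)) = inner ℂ (f (b i)) (f (b i)) := by
      rw [LinearMap.comp_apply, LinearMap.adjoint_inner_right]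
    rw [hb, f.isSymmetric_adjoint_comp_self.apply_eigenvectorBasis rfl i, ← hb, inner_smul_right,
      inner_self_eq_norm_sq_to_K, inner_self_eq_norm_sq_to_K, b.norm_eq_one] at h2
    simpa using h2.symm
  rw [← Complex.ofReal_inj.1 h1]
  have h3 := hK (b i)
  rw [b.norm_eq_one, mul_one] at h3
  exact pow_le_pow_left₀ (norm_nonneg _) h3 2

theorem log_geomDet_le_trace (f : V →ₗ[ℂ] W) {K : ℝ} (hK : ∀ x, ‖f x‖ ≤ K * ‖x‖)
    {p : Polynomial ℝ} (hp : ∀ t ∈ Icc 0 (K ^ 2), Real.log t ≤ p.eval t) :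
    2 * Real.log (geomDet f) ≤
      p.sum fun k c => c * (LinearMap.trace ℂ V ((f.adjoint ∘ₗ f) ^ k)).re := by
  rw [log_geomDet]
  refine (Finset.sum_le_sum fun i _ =>
    hp _ (eigenvalues_adjoint_comp_self_mem_Icc f hK i)).trans_eq ?_
  simp only [trace_pow_eq_sum_eigenvalues f.isSymmetric_adjoint_comp_self, Complex.re_sum,
    Complex.ofReal_re, Polynomial.eval_eq_sum, Polynomial.sum, Finset.mul_sum]
  exact Finset.sum_comm

end GeomDet

/-! ## Comparison of the two determinants -/

section Comparison

variable {G : Type*} [Group G] {n m : ℕ}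

theorem gramOp_pow (B : Matrix (Fin n) (Fin m) (MonoidAlgebra ℂ G)) (k : ℕ) :
    gramOp B ^ k = matMul (regularAction G) ((B * matStar B) ^ k) := by
  rw [matMul_pow, matMul_mul, gramOp, adjoint_matMul]

theorem adjoint_comp_cosetOp_pow (Γ : Subgroup G) [Γ.FiniteIndex]
    (B : Matrix (Fin n) (Fin m) (MonoidAlgebra ℂ G)) (k : ℕ) :
    (LinearMap.adjoint (cosetOp Γ B) ∘ₗ cosetOp Γ B) ^ k =
      (matMul (cosetAction Γ) ((B * matStar B) ^ k)).toLinearMap := by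
  have h : LinearMap.adjoint (cosetOp Γ B) ∘ₗ cosetOp Γ B =
      (matMul (cosetAction Γ) (B * matStar B)).toLinearMap := by
    rw [matMul_mul, ← adjoint_matMul]
    rfl
  rw [h, matMul_pow]
  induction k with
  | zero => rfl
  | succ k ih => rw [pow_succ, ih, pow_succ]; rfl

theorem norm_gramOp_le (B : Matrix (Fin n) (Fin m) (MonoidAlgebra ℂ G)) :
    ‖gramOp B‖ ≤ matNormBound B ^ 2 := by
  have h := norm_matMul_le (regularAction G) B
  refine (ContinuousLinearMap.opNorm_comp_le _ _).trans ?_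
  rw [LinearIsometryEquiv.norm_map, sq]
  exact mul_self_le_mul_self (norm_nonneg _) h

/-- A possible atom of `dF` at `0` is invisible since `Real.log 0 = 0`, so `∫` over `(0, ∞)` may be
replaced by `∫` over `ℝ`. -/
theorem log_fugledeKadisonDet {B : Matrix (Fin n) (Fin m) (MonoidAlgebra ℂ G)}
    (hB : IsDetClass B) :
    Integrable Real.log (spectralDensity B).toStieltjesFunction.measure ∧
      2 * Real.log (fugledeKadisonDet B) =
        ∫ t, Real.log t ∂(spectralDensity B).toStieltjesFunction.measure := by
  obtain ⟨-, hsupp, -⟩ := spectralDensity_measure B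
  have hae : (Ioi (0 : ℝ)).indicator Real.log
      =ᵐ[(spectralDensity B).toStieltjesFunction.measure] Real.log := by
    filter_upwards [hsupp] with t ht
    rcases ht.1.eq_or_lt with rfl | h0
    · simp
    · rw [indicator_of_mem (mem_Ioi.2 h0)]
  refine ⟨((integrable_indicator_iff measurableSet_Ioi).2 hB).congr hae, ?_⟩
  have hdet : (spectralDensity B).det = Real.exp
      (∫ x in Ioi 0, Real.log x ∂(spectralDensity B).toStieltjesFunction.measure) := if_pos hB
  rw [fugledeKadisonDet, Real.log_sqrt (hdet ▸ (Real.exp_pos _).le), hdet, Real.log_exp,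
    mul_div_cancel₀ _ two_ne_zero, ← integral_indicator measurableSet_Ioi]
  exact integral_congr_ae hae

theorem eventually_log_geomDet_div_index_le
    {B : Matrix (Fin n) (Fin m) (MonoidAlgebra ℂ G)} (hB : IsDetClass B)
    {Γ : ℕ → FinIndexSubgroup G} (hΓ : TraceConverges Γ) {ε : ℝ} (hε : 0 < ε) :
    ∀ᶠ k in atTop, Real.log (geomDet (cosetOp (Γ k).1 B)) / ((Γ k).1.index : ℝ) ≤
      Real.log (fugledeKadisonDet B) + ε := by
  obtain ⟨hfin, hsupp, hpoly⟩ := spectralDensity_measure B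
  obtain ⟨hint, hlog⟩ := log_fugledeKadisonDet hB
  have hsupp' : ∀ᵐ t ∂(spectralDensity B).toStieltjesFunction.measure,
      t ∈ Icc 0 (matNormBound B ^ 2) := by
    filter_upwards [hsupp] with t ht
    exact ⟨ht.1, ht.2.trans (norm_gramOp_le B)⟩
  -- The error is `2 * ε` because both determinants enter through twice their logarithm.
  obtain ⟨p, hp, hpint⟩ := exists_polynomial_log_le _ hsupp' hint (by linarith : 0 < 2 * ε)
  rw [hpoly, ← hlog] at hpint
  have hlim : Tendsto (fun k => p.sum fun l c => c *
      (LinearMap.trace ℂ _ (matMul (cosetAction (Γ k).1) ((B * matStar B) ^ l)).toLinearMap /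
        ((Γ k).1.index : ℂ)).re) atTop
      (𝓝 (p.sum fun l c => c * (vnTrace (gramOp B ^ l)).re)) := by
    refine tendsto_finsetSum _ fun l _ => Tendsto.const_mul _ ?_
    rw [gramOp_pow]
    exact (Complex.continuous_re.tendsto _).comp (tendsto_trace_matMul hΓ _)
  filter_upwards [hlim.eventually_lt_const hpint] with k hk
  have hidx : (0 : ℝ) < (Γ k).1.index :=
    Nat.cast_pos.2 (Nat.pos_of_ne_zero Subgroup.FiniteIndex.index_ne_zero)
  have h1 := log_geomDet_le_trace (cosetOp (Γ k).1 B)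
    (fun x => (matMul (cosetAction (Γ k).1) B).le_of_opNorm_le (norm_matMul_le _ B) x) hp
  simp only [adjoint_comp_cosetOp_pow] at h1
  have h2 : (p.sum fun l c => c *
      (LinearMap.trace ℂ _ (matMul (cosetAction (Γ k).1) ((B * matStar B) ^ l)).toLinearMap /
        ((Γ k).1.index : ℂ)).re) = (p.sum fun l c => c *
      (LinearMap.trace ℂ _
        (matMul (cosetAction (Γ k).1) ((B * matStar B) ^ l)).toLinearMap).re) /
        ((Γ k).1.index : ℝ) := by
    simp only [Polynomial.sum, Finset.sum_div, mul_div_assoc]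
    refine Finset.sum_congr rfl fun l _ => ?_
    rw [← Complex.ofReal_natCast, Complex.div_ofReal_re]
  rw [h2, div_lt_iff₀ hidx] at hk
  rw [div_le_iff₀ hidx]
  linarith

end Comparison

end L2Det

end

theorem theorem3p3 {G : Type*} [Group G] (n m : ℕ)
    (B : Matrix (Fin n) (Fin m) (MonoidAlgebra ℤ G))
    (hB : L2Det.IsDetClass (L2Det.complexify B)) :
    L2Det.trLimsup (fun Γ : L2Det.FinIndexSubgroup G =>
        Real.log (L2Det.geomDet (L2Det.cosetOp Γ.1 (L2Det.complexify B))) / (Γ.1.index : ℝ)) ≤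
      ((Real.log (L2Det.fugledeKadisonDet (L2Det.complexify B)) : ℝ) : EReal) := by
  refine sInf_le fun Γ hΓ => ?_
  -- It suffices to bound the limsup by each real `x` above the right-hand side; the gap serves as
  -- `ε`.
  refine EReal.le_of_forall_lt_iff_le.1 fun x hx => ?_
  have hε : 0 < x - Real.log (L2Det.fugledeKadisonDet (L2Det.complexify B)) :=
    sub_pos.2 (EReal.coe_lt_coe_iff.1 hx)
  refine Filter.limsup_le_of_le (by isBoundedDefault) ?_
  filter_upwards [L2Det.eventually_log_geomDet_div_index_le hB hΓ hε] with k hk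
  rw [EReal.coe_le_coe_iff]
  linarith
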